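/- Let $V$ be a finite nonempty set, let $n\in\mathbb R$, and let $H_n\subset\mathbb R^V$ be the affine hyperplane of all $q$ with $\sum_{v\in V}q(v)=n$; write $q(I)=\sum_{v\in I}q(v)$ for $I\subseteq V$. A function $\mu\colon 2^V\to\mathbb R$ is supermodular if $\mu(\emptyset)=0$ and $\mu(I_1)+\mu(I_2)\le\mu(I_1\cup I_2)+\mu(I_1\cap I_2)$ for all $I_1,I_2\subseteq V$; its range is $\mu(V)$. Put $\mu^*(I)=\mu(V)-\mu(V\setminus I)$ and let $\mathbf P_\mu=\{q\in\mathbb R^V : \mu(I)\le q(I)\le\mu^*(I)\text{ for all }I\subseteq V\}$. A bipartition of $V$ is an ordered pair $\pi=(I,J)$ of disjoint nonempty subsets with $I\sqcup J=V$; put $\pi^c=(J,I)$, and define the splitting $\mu_\pi$ by $\mu_\pi(S)=\mu(S\cap I)+\mu(S\cup I)-\mu(I)$ for $S\subseteq V$. The spread of $\mu$ is the minimum of $\mu^*(I)-\mu(I)$ over nonempty proper subsets $I\subset V$ (and $0$ if $|V|=1$). Let $\mathscr C$ be a family of supermodular functions on $2^V$ of range $n$, and let $\mathbf P_{\mathscr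 C}=\bigcup_{\mu\in\mathscr C}\mathbf P_\mu$ be its support. For $\Omega\subseteq H_n$, say that $\mathscr C$ is complete for $\Omega$ if for each $\mu\in\mathscr C$ and each bipartition $\pi$ of $V$ such that $\mathbf P_{\mu_\pi}$ intersects $\Omega$, there is $\mu'\in\mathscr C$ with $\mu'\neq\mu_\pi$ and $\mu'_{\pi^c}=\mu_\pi$. Say that $\mathscr C$ is positive if some element of $\mathscr C$ has positive spread and the infimum of the positive spreads of elements of $\mathscr C$ is positive. Theorem. Let $\Omega$ be a connected open subset of $H_n$ such that $\mathbf P_{\mathscr C}\cap\Omega\neq\emptyset$. If $\mathscr C$ is complete for $\Omega$ and positive, then $\mathbf P_{\mathscr C}\supseteq\Omega$. -/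

import Mathlib

namespace SupermodularTiling

variable {V : Type*} [Fintype V] [DecidableEq V]

/-- `μ : 2^V → ℝ` is supermodular (this includes `μ ∅ = 0`). -/
structure IsSupermodular (μ : Finset V → ℝ) : Prop where
  map_empty : μ ∅ = 0
  add_le : ∀ I₁ I₂ : Finset V, μ I₁ + μ I₂ ≤ μ (I₁ ∪ I₂) + μ (I₁ ∩ I₂)

/-- The set of supermodular functions on `2^V` of range `n`, that is, with `μ V = n`. -/
def supermodularOfRange (V : Type*) [Fintype V] [DecidableEq V] (n : ℝ) :
    Set (Finset V → ℝ) :=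
  {μ | IsSupermodular μ ∧ μ Finset.univ = n}

/-- The affine hyperplane `H_n` of all `q : V → ℝ` whose coordinates sum to `n`. -/
def hyperplane (V : Type*) [Fintype V] (n : ℝ) : Set (V → ℝ) :=
  {q | ∑ v, q v = n}

/-- The adjoint function `μ^*(I) = μ(V) - μ(V \ I)`. -/
def adjoint (μ : Finset V → ℝ) (I : Finset V) : ℝ :=
  μ Finset.univ - μ Iᶜ

/-- The base polytope `P_μ`: all `q` with `μ(I) ≤ q(I) ≤ μ^*(I)` for every `I ⊆ V`, where
`q(I)` is the sum of the `q v` over `v ∈ I`. -/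
def basePolytope (μ : Finset V → ℝ) : Set (V → ℝ) :=
  {q | ∀ I : Finset V, μ I ≤ ∑ v ∈ I, q v ∧ ∑ v ∈ I, q v ≤ adjoint μ I}

/-- `(I, J)` is an (ordered) bipartition of `V`: both parts are nonempty, they are disjoint,
and their union is `V`. -/
structure IsBipartition (I J : Finset V) : Prop where
  left_nonempty : I.Nonempty
  right_nonempty : J.Nonempty
  disjoint : Disjoint I J
  union_eq : I ∪ J = Finset.univ

/-- The splitting `μ_π` of `μ` with respect to the bipartition `π = (I, J)`; it depends only on
the first part `I`, since `J` is the complement of `I`. -/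
def splitting (μ : Finset V → ℝ) (I _J : Finset V) : Finset V → ℝ :=
  fun S => μ (S ∩ I) + (μ (S ∪ I) - μ I)

/-- The spread of `μ`: the minimum of `μ^*(I) - μ(I)` over the nonempty proper subsets `I` of
`V` (a finite set of reals, so that `sInf` is the minimum). If `V` has one element, there is no
such `I`, and `sInf ∅ = 0` is the usual convention. -/
noncomputable def spread (μ : Finset V → ℝ) : ℝ :=
  sInf ((fun I : Finset V => adjoint μ I - μ I) '' {I | I.Nonempty ∧ I ≠ Finset.univ})

/-- The support `P_C` of a family `C`: the union of the polytopes `P_μ` for `μ ∈ C`. -/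
def support (C : Set (Finset V → ℝ)) : Set (V → ℝ) :=
  ⋃ μ ∈ C, basePolytope μ

/-- `C` is complete for `Ω`: for each `μ ∈ C` and each bipartition `π = (I, J)` such that
`P_{μ_π}` meets `Ω`, there is `μ' ∈ C` distinct from `μ_π` with `μ'_{(J, I)} = μ_π`. -/
def IsCompleteFor (C : Set (Finset V → ℝ)) (Ω : Set (V → ℝ)) : Prop :=
  ∀ μ ∈ C, ∀ I J : Finset V, IsBipartition I J →
    (basePolytope (splitting μ I J) ∩ Ω).Nonempty →
      ∃ μ' ∈ C, μ' ≠ splitting μ I J ∧ splitting μ' J I = splitting μ I J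

/-- `C` is positive: the infimum of the positive spreads of elements of `C` is positive. Some
element of `C` must have positive spread (`sInf ∅ = 0` is not positive). -/
def IsPositiveFamily (C : Set (Finset V → ℝ)) : Prop :=
  0 < sInf {s : ℝ | ∃ μ ∈ C, spread μ = s ∧ 0 < s}

end SupermodularTiling

namespace SupermodularTiling

variable {V : Type*} [DecidableEq V]

/-! Membership in the support is locally constant on Ω, so connectedness finishes the proof. Nearby
points are joined by moves along `e_b - e_a` of length τ with 2τ < ε, where ε is the infimum of the
positive spreads; the core is `transfer_mem_support`, that such a move stays in the support.

Follow the segment through the polytopes. If that of μ, of positive spread, ends too early, some I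
with a ∈ I, b ∉ I is tight; the point then lies in the polytope of the splitting along I, and
completeness supplies a neighbour containing it. The danger is to cross forever. Let X be the set of
elements that eventually lie in every crossing set. Supermodularity carries lower bounds for μ - q
to X from later crossings and to Xᶜ from earlier ones, losing at most the distance travelled. Hence
μ(X) + μ(Xᶜ) > n - ε at late times, which a spread of at least ε forbids (`no_infinite_crossing`).

Functions of zero spread escape this bound. They are crossed through a separating set, which lowers
the number of separating sets (`card_separators_lt`), so positive spread must recur. -/

/-! ### Splittings, tight sets and transfers -/

theorem IsSupermodular.le_splitting {μ : Finset V → ℝ} (h : IsSupermodular μ) (I J S : Finset V) :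
    μ S ≤ splitting μ I J S := by
  have := h.add_le S I
  unfold splitting
  linarith

/-- If `I` is tight for `q`, then `q` lies above the splitting of `μ` along `I`, with an excess
controlled by the excess on `S ∩ I`. -/
theorem splitting_sub_le {μ : Finset V → ℝ} {q : V → ℝ} {I : Finset V}
    (hle : ∀ S, μ S ≤ ∑ v ∈ S, q v) (hI : μ I = ∑ v ∈ I, q v) (J S : Finset V) :
    splitting μ I J S - ∑ v ∈ S, q v ≤ μ (S ∩ I) - ∑ v ∈ S ∩ I, q v := by
  have h1 := hle (S ∪ I)
  have h2 := Finset.sum_union_inter (s₁ := S) (s₂ := I) (f := q)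
  unfold splitting
  linarith

/-- This places the point in the polytope of the splitting along a tight set, which is what triggers
completeness. -/
theorem splitting_le {μ : Finset V → ℝ} {q : V → ℝ} {I : Finset V}
    (hle : ∀ S, μ S ≤ ∑ v ∈ S, q v) (hI : μ I = ∑ v ∈ I, q v) (J S : Finset V) :
    splitting μ I J S ≤ ∑ v ∈ S, q v := by
  have h1 := splitting_sub_le hle hI J S
  have h2 := hle (S ∩ I)
  linarith

/-- The point at distance `s` from `x` in the direction `e_b - e_a`. -/
def transfer (x : V → ℝ) (a b : V) (s : ℝ) : V → ℝ :=
  x + s • (Pi.single b 1 - Pi.single a 1)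

theorem sum_transfer (x : V → ℝ) (a b : V) (s : ℝ) (S : Finset V) :
    ∑ v ∈ S, transfer x a b s v =
      ∑ v ∈ S, x v + s * ((if b ∈ S then 1 else 0) - if a ∈ S then 1 else 0) := by
  simp [transfer, Finset.sum_add_distrib, ← Finset.mul_sum, Finset.sum_sub_distrib, Pi.single_apply]

variable [Fintype V]

/-- Once the total is right, the upper bound on a set is the lower bound on its complement. -/
theorem mem_basePolytope_iff {μ : Finset V → ℝ} {q : V → ℝ} (hq : ∑ v, q v = μ Finset.univ) :
    q ∈ basePolytope μ ↔ ∀ S, μ S ≤ ∑ v ∈ S, q v := by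
  refine ⟨fun h S => (h S).1, fun h S => ⟨h S, ?_⟩⟩
  have h1 := h Sᶜ
  have h2 := Finset.sum_add_sum_compl S q
  unfold adjoint
  linarith

/-- Across a set `I`, the excess on `S ∪ Iᶜ` of the neighbour of `μ` is at most that of `μ`
on `S`. -/
theorem sub_le_neighbour_union_compl {μ μ' : Finset V → ℝ} {q : V → ℝ} {I : Finset V}
    (hμ : IsSupermodular μ) (hle : ∀ S, μ S ≤ ∑ v ∈ S, q v) (hq : ∑ v, q v = μ Finset.univ)
    (hs : splitting μ' Iᶜ I = splitting μ I Iᶜ) (S : Finset V) :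
    μ S - ∑ v ∈ S, q v ≤ μ' (S ∪ Iᶜ) - ∑ v ∈ S ∪ Iᶜ, q v := by
  have h := congrFun hs (S ∪ Iᶜ)
  have e1 : (S ∪ Iᶜ) ∩ Iᶜ = Iᶜ := by ext v; simp
  have e2 : S ∪ Iᶜ ∪ Iᶜ = S ∪ Iᶜ := by ext v; simp
  have e3 : (S ∪ Iᶜ) ∩ I = S ∩ I := by ext v; simp; tauto
  have e4 : S ∪ Iᶜ ∪ I = Finset.univ := by ext v; simp; tauto
  simp only [splitting, e1, e2, e3, e4] at h
  have h1 := hμ.add_le S I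
  have h2 := hle (S ∪ I)
  have h3 := Finset.sum_union_inter (s₁ := S) (s₂ := I) (f := q)
  have h4 := Finset.sum_union_inter (s₁ := S ∪ Iᶜ) (s₂ := I) (f := q)
  rw [e3, e4] at h4
  linarith

theorem sum_univ_transfer (x : V → ℝ) (a b : V) (s : ℝ) :
    ∑ v, transfer x a b s v = ∑ v, x v := by
  simp [sum_transfer]

/-! ### Separating sets -/

/-- A set separates `μ` if it is nonempty and proper and `μ` is additive on it and its
complement. -/
def Separates (μ : Finset V → ℝ) (K : Finset V) : Prop :=
  K.Nonempty ∧ K ≠ Finset.univ ∧ μ K + μ Kᶜ = μ Finset.univ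

/-- All of the polytope lies in the hyperplane where I is tight, so the face cut out by I is
everything. Supermodularity for the pairs (S ∪ I, Iᶜ) and (S ∩ I, S ∩ Iᶜ) gives the missing
inequality. -/
theorem IsSupermodular.splitting_eq_of_separates {μ : Finset V → ℝ} (h : IsSupermodular μ)
    {I : Finset V} (hI : Separates μ I) (J : Finset V) : splitting μ I J = μ := by
  funext S
  refine le_antisymm ?_ (h.le_splitting I J S)
  have h1 := h.add_le (S ∪ I) Iᶜ
  have e1 : S ∪ I ∪ Iᶜ = Finset.univ := by ext v; simp
  have e2 : (S ∪ I) ∩ Iᶜ = S ∩ Iᶜ := by ext v; simp +contextual [or_and_right]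
  rw [e1, e2] at h1
  have h2 := h.add_le (S ∩ I) (S ∩ Iᶜ)
  have e3 : S ∩ I ∪ S ∩ Iᶜ = S := by ext v; simp; tauto
  have e4 : S ∩ I ∩ (S ∩ Iᶜ) = ∅ := by ext v; simp; tauto
  rw [e3, e4, h.map_empty] at h2
  have h3 := hI.2.2
  unfold splitting
  linarith

theorem Separates.compl {μ : Finset V → ℝ} {K : Finset V} (h : Separates μ K) :
    Separates μ Kᶜ := by
  refine ⟨?_, ?_, ?_⟩
  · rw [Finset.nonempty_iff_ne_empty]
    simpa using h.2.1
  · simpa using h.1.ne_empty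
  · rw [compl_compl, add_comm]
    exact h.2.2

open Classical in
/-- The finite set of all sets that separate `μ`. -/
noncomputable def separators (μ : Finset V → ℝ) : Finset (Finset V) :=
  Finset.univ.filter (Separates μ)

/-- Passing to a proper neighbour across a separating set removes separating sets. -/
theorem card_separators_lt {μ μ' : Finset V → ℝ} {I : Finset V} (hμ : IsSupermodular μ)
    (hμ' : IsSupermodular μ') (hn : μ' Finset.univ = μ Finset.univ) (hI : Separates μ I)
    (hne : μ' ≠ splitting μ I Iᶜ) (hs : splitting μ' Iᶜ I = splitting μ I Iᶜ) :
    (separators μ').card < (separators μ).card := by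
  apply Finset.card_lt_card
  have hle : ∀ S, μ' S ≤ μ S := fun S => by
    have := hμ'.le_splitting Iᶜ I S
    rwa [hs, hμ.splitting_eq_of_separates hI] at this
  rw [Finset.ssubset_iff_of_subset]
  · refine ⟨I, by simpa [separators] using hI, fun hmem => hne ?_⟩
    have hI' : Separates μ' I := by simpa [separators] using hmem
    rw [← hs, hμ'.splitting_eq_of_separates hI'.compl]
  · intro K hK
    simp only [separators, Finset.mem_filter, Finset.mem_univ, true_and] at hK ⊢
    refine ⟨hK.1, hK.2.1, le_antisymm ?_ ?_⟩
    · have := hμ.add_le K Kᶜ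
      simpa [hμ.map_empty] using this
    · have h1 := hle K
      have h2 := hle Kᶜ
      have h3 := hK.2.2
      linarith

/-! ### Crossing polytopes along a segment -/

/-- Along a segment in the direction `e_b - e_a`, a point of a base polytope can be moved to the
end of the segment or to a point where some set containing `a` but not `b` is tight. -/
theorem exists_blocking {μ : Finset V → ℝ} {x : V → ℝ} {a b : V} (hab : a ≠ b) {s τ : ℝ}
    (hle : ∀ S, μ S ≤ ∑ v ∈ S, transfer x a b s v) (hsτ : s ≤ τ) :
    (∀ S, μ S ≤ ∑ v ∈ S, transfer x a b τ v) ∨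
      ∃ s', s ≤ s' ∧ s' ≤ τ ∧ (∀ S, μ S ≤ ∑ v ∈ S, transfer x a b s' v) ∧
        ∃ I, a ∈ I ∧ b ∉ I ∧ μ I = ∑ v ∈ I, transfer x a b s' v := by
  classical
  -- Only sets containing a but not b lose slack, all at unit speed, so the one with least slack at
  -- x is tight first.
  obtain ⟨I, hI, hmin⟩ := Finset.exists_min_image
    (Finset.univ.filter fun S : Finset V => a ∈ S ∧ b ∉ S) (fun S => ∑ v ∈ S, x v - μ S)
    ⟨{a}, by simpa using hab.symm⟩
  simp only [Finset.mem_filter, Finset.mem_univ, true_and] at hI hmin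
  have key : ∀ t, s ≤ t → t ≤ ∑ v ∈ I, x v - μ I → ∀ S, μ S ≤ ∑ v ∈ S, transfer x a b t v := by
    intro t hst ht S
    have h1 := hle S
    rw [sum_transfer] at h1 ⊢
    by_cases ha : a ∈ S <;> by_cases hb : b ∈ S <;> simp only [ha, hb, if_true, if_false] at h1 ⊢
    · linarith
    · have := hmin S ⟨ha, hb⟩
      linarith
    · linarith
    · linarith
  rcases le_total τ (∑ v ∈ I, x v - μ I) with h | h
  · exact Or.inl (key τ hsτ h)
  · have hs : s ≤ ∑ v ∈ I, x v - μ I := by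
      have h1 := hle I
      rw [sum_transfer] at h1
      simp only [hI.1, hI.2, if_true, if_false] at h1
      linarith
    refine Or.inr ⟨_, hs, h, key _ hs le_rfl, I, hI.1, hI.2, ?_⟩
    rw [sum_transfer]
    simp only [hI.1, hI.2, if_true, if_false]
    ring

/-- There is no infinite sequence of crossings along a short segment, all of them through tight
sets that contain `a`, in which the spread is bounded below infinitely often. -/
theorem no_infinite_crossing {n ε τ : ℝ} {x : V → ℝ} (hx : ∑ v, x v = n) {a b : V}
    {s : ℕ → ℝ} {μ : ℕ → Finset V → ℝ} {I : ℕ → Finset V}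
    (hμ : ∀ k, IsSupermodular (μ k)) (hn : ∀ k, μ k Finset.univ = n)
    (hle : ∀ k S, μ k S ≤ ∑ v ∈ S, transfer x a b (s k) v)
    (htight : ∀ k, μ k (I k) = ∑ v ∈ I k, transfer x a b (s k) v)
    (ha : ∀ k, a ∈ I k) (hI : ∀ k, I k ≠ Finset.univ)
    (hstep : ∀ k, splitting (μ (k + 1)) (I k)ᶜ (I k) = splitting (μ k) (I k) (I k)ᶜ)
    (hmono : Monotone s) (h0 : ∀ k, 0 ≤ s k) (hτ : ∀ k, s k ≤ τ) (hε : 2 * τ < ε)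
    (hgood : ∀ k, ∃ l, k ≤ l ∧
      ∀ K : Finset V, K.Nonempty → K ≠ Finset.univ → μ l K + μ l Kᶜ ≤ n - ε) : False := by
  classical
  -- The induction peels off the first crossing, hence k varies. The window includes k + m, so the
  -- base case is the tightness of I k.
  have hinter : ∀ m k, -(s (k + m) - s k) ≤
      μ k (Finset.univ.filter fun v => ∀ j, k ≤ j → j ≤ k + m → v ∈ I j) -
        ∑ v ∈ Finset.univ.filter fun v => ∀ j, k ≤ j → j ≤ k + m → v ∈ I j,
          transfer x a b (s k) v := by
    intro m
    induction m with
    | zero =>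
      intro k
      have e : (Finset.univ.filter fun v => ∀ j, k ≤ j → j ≤ k + 0 → v ∈ I j) = I k := by
        ext v
        simp only [Finset.mem_filter, Finset.mem_univ, true_and, add_zero]
        exact ⟨fun h => h k le_rfl le_rfl, fun h j h1 h2 => le_antisymm h2 h1 ▸ h⟩
      rw [e, htight k]
      simp
    | succ m ih =>
      intro k
      have h1 := ih (k + 1)
      set T := Finset.univ.filter fun v => ∀ j, k + 1 ≤ j → j ≤ k + 1 + m → v ∈ I j with hT
      have e : (Finset.univ.filter fun v => ∀ j, k ≤ j → j ≤ k + (m + 1) → v ∈ I j) =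
          T ∩ I k := by
        ext v
        simp only [hT, Finset.mem_filter, Finset.mem_univ, true_and, Finset.mem_inter]
        refine ⟨fun h => ⟨fun j h1 h2 => h j (by omega) (by omega), h k le_rfl (by omega)⟩,
          fun h j h1 h2 => ?_⟩
        rcases h1.eq_or_lt with rfl | h3
        · exact h.2
        · exact h.1 j h3 (by omega)
      have haT : a ∈ T := by simp [hT, ha]
      have h2 := splitting_sub_le (hle k) (htight k) (I k)ᶜ T
      have h3 := (hμ (k + 1)).le_splitting (I k)ᶜ (I k) T
      rw [hstep k] at h3
      have h4 := hmono (Nat.le_succ k)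
      rw [e, show k + (m + 1) = k + 1 + m by ring]
      rw [sum_transfer] at h1 h2
      simp only [haT, if_true] at h1 h2
      split_ifs at h1 h2 <;> simp only [Nat.succ_eq_add_one] at h4 <;> linarith
  -- Here the last crossing is peeled off. The window excludes k + m, since μ (k + m) is reached
  -- before I (k + m) is crossed.
  have hunion : ∀ m k, -(s (k + m) - s k) ≤
      μ (k + m) (Finset.univ.filter fun v => ∃ j, k ≤ j ∧ j < k + m ∧ v ∉ I j) -
        ∑ v ∈ Finset.univ.filter fun v => ∃ j, k ≤ j ∧ j < k + m ∧ v ∉ I j,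
          transfer x a b (s (k + m)) v := by
    intro m k
    induction m with
    | zero =>
      have e : (Finset.univ.filter fun v => ∃ j, k ≤ j ∧ j < k + 0 ∧ v ∉ I j) = ∅ := by
        ext v
        simp only [Finset.mem_filter, Finset.mem_univ, true_and, add_zero, Finset.notMem_empty,
          iff_false]
        rintro ⟨j, h1, h2, -⟩
        omega
      rw [e, (hμ _).map_empty]
      simp
    | succ m ih =>
      set S := Finset.univ.filter fun v => ∃ j, k ≤ j ∧ j < k + m ∧ v ∉ I j with hS
      have e : (Finset.univ.filter fun v => ∃ j, k ≤ j ∧ j < k + (m + 1) ∧ v ∉ I j) =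
          S ∪ (I (k + m))ᶜ := by
        ext v
        simp only [hS, Finset.mem_filter, Finset.mem_univ, true_and, Finset.mem_union,
          Finset.mem_compl]
        constructor
        · rintro ⟨j, h1, h2, h3⟩
          rcases (Nat.lt_succ_iff.1 h2).eq_or_lt with rfl | h4
          · exact Or.inr h3
          · exact Or.inl ⟨j, h1, h4, h3⟩
        · rintro (⟨j, h1, h2, h3⟩ | h)
          · exact ⟨j, h1, by omega, h3⟩
          · exact ⟨k + m, by omega, by omega, h⟩
      have haS : a ∉ S ∪ (I (k + m))ᶜ := by simp [hS, ha]
      have h2 := sub_le_neighbour_union_compl (hμ _) (hle _)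
        (by rw [sum_univ_transfer, hx, hn]) (hstep (k + m)) S
      have h4 := hmono (Nat.le_succ (k + m))
      rw [e, show k + (m + 1) = k + m + 1 by ring]
      rw [sum_transfer _ _ _ _ (S ∪ _)] at h2 ⊢
      simp only [haS, if_false] at h2 ⊢
      split_ifs at h2 ⊢ <;> simp only [Nat.succ_eq_add_one] at h4 <;> linarith
  let X : Finset V := Finset.univ.filter fun v => ∃ k, ∀ j, k ≤ j → v ∈ I j
  have hXmem : ∀ v, v ∈ X ↔ ∃ k, ∀ j, k ≤ j → v ∈ I j := fun v => by simp [X]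
  -- a time after which the elements of `X` always lie in the crossing sets
  have hk0 : ∃ k₀, ∀ v ∈ X, ∀ j, k₀ ≤ j → v ∈ I j := by
    have : ∀ v, ∃ k, v ∈ X → ∀ j, k ≤ j → v ∈ I j := fun v => by
      by_cases h : v ∈ X
      · obtain ⟨k, hk⟩ := (hXmem v).1 h
        exact ⟨k, fun _ => hk⟩
      · exact ⟨0, fun h' => absurd h' h⟩
    choose f hf using this
    exact ⟨Finset.univ.sup f, fun v hv j hj =>
      hf v hv j ((Finset.le_sup (Finset.mem_univ v)).trans hj)⟩
  obtain ⟨k₀, hk₀⟩ := hk0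
  have hout : ∀ k, ∃ m, ∀ v, v ∉ X → ∃ j, k ≤ j ∧ j < k + m ∧ v ∉ I j := by
    intro k
    have : ∀ v, ∃ j, v ∉ X → k ≤ j ∧ v ∉ I j := fun v => by
      by_cases h : v ∈ X
      · exact ⟨0, fun h' => absurd h h'⟩
      · have : ¬ ∀ j, k ≤ j → v ∈ I j := fun h' => h ((hXmem v).2 ⟨k, h'⟩)
        push Not at this
        obtain ⟨j, hj⟩ := this
        exact ⟨j, fun _ => hj⟩
    choose f hf using this
    refine ⟨Finset.univ.sup f + 1, fun v hv => ⟨f v, (hf v hv).1, ?_, (hf v hv).2⟩⟩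
    have := Finset.le_sup (f := f) (Finset.mem_univ v)
    omega
  obtain ⟨m, hm⟩ := hout k₀
  obtain ⟨l, hl, hspread⟩ := hgood (k₀ + m)
  obtain ⟨p, rfl⟩ := Nat.exists_eq_add_of_le (le_trans (Nat.le_add_right _ _) hl)
  -- At time k₀ + p, the past window already gives Xᶜ as its union; this future window is long
  -- enough for its intersection to be X.
  obtain ⟨m', hm'⟩ := hout (k₀ + p)
  have e1 : (Finset.univ.filter fun v => ∃ j, k₀ ≤ j ∧ j < k₀ + p ∧ v ∉ I j) = Xᶜ := by
    ext v
    simp only [Finset.mem_filter, Finset.mem_univ, true_and, Finset.mem_compl]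
    constructor
    · rintro ⟨j, h1, h2, h3⟩ h
      exact h3 (hk₀ v h j h1)
    · intro h
      obtain ⟨j, h1, h2, h3⟩ := hm v h
      exact ⟨j, h1, by omega, h3⟩
  have e2 : (Finset.univ.filter fun v => ∀ j, k₀ + p ≤ j → j ≤ k₀ + p + m' → v ∈ I j) = X := by
    ext v
    simp only [Finset.mem_filter, Finset.mem_univ, true_and]
    constructor
    · intro h
      by_contra hv
      obtain ⟨j, h1, h2, h3⟩ := hm' v hv
      exact h3 (h j h1 h2.le)
    · exact fun h j h1 _ => hk₀ v h j (by omega)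
  have h1 := hunion p k₀
  have h2 := hinter m' (k₀ + p)
  rw [e1] at h1
  rw [e2] at h2
  have h3 := hspread X ⟨a, (hXmem a).2 ⟨0, fun j _ => ha j⟩⟩ fun h =>
    hI k₀ (Finset.eq_univ_iff_forall.2 fun v => hk₀ v (h ▸ Finset.mem_univ v) k₀ le_rfl)
  have h4 := Finset.sum_add_sum_compl X (transfer x a b (s (k₀ + p)))
  rw [sum_univ_transfer, hx] at h4
  linarith [hτ (k₀ + p), hτ (k₀ + p + m'), h0 k₀, h0 (k₀ + p)]

/-- The spread is an attained minimum of nonnegative numbers, so were it zero, a minimizer would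
separate μ. -/
theorem add_compl_le_of_forall_not_separates {μ : Finset V → ℝ} (hμ : IsSupermodular μ) {ε : ℝ}
    (hε : 0 < spread μ → ε ≤ spread μ) (h : ∀ K, ¬ Separates μ K) {K : Finset V}
    (hK : K.Nonempty) (hK' : K ≠ Finset.univ) : μ K + μ Kᶜ ≤ μ Finset.univ - ε := by
  have hfin : ((fun I : Finset V => adjoint μ I - μ I) ''
      {I | I.Nonempty ∧ I ≠ Finset.univ}).Finite := Set.toFinite _
  have hle : spread μ ≤ adjoint μ K - μ K :=
    csInf_le hfin.bddBelow ⟨K, ⟨hK, hK'⟩, rfl⟩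
  have hpos : 0 < spread μ := by
    have hne : {I : Finset V | I.Nonempty ∧ I ≠ Finset.univ}.Nonempty := ⟨K, hK, hK'⟩
    obtain ⟨L, hL, hLs⟩ := (hne.image fun I => adjoint μ I - μ I).csInf_mem hfin
    have h1 : spread μ = adjoint μ L - μ L := hLs.symm
    have h2 := hμ.add_le L Lᶜ
    simp only [Finset.union_compl, Finset.inter_compl, hμ.map_empty, add_zero] at h2
    have h3 := h2.lt_of_ne fun h4 => h L ⟨hL.1, hL.2, h4⟩
    unfold adjoint at h1
    linarith
  have := hε hpos
  unfold adjoint at hle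
  linarith

/-! ### Short moves stay in the support -/

/-- The support of a complete family is closed under short moves in the directions `e_b - e_a`. -/
theorem transfer_mem_support {n ε τ : ℝ} {C : Set (Finset V → ℝ)}
    (hC : C ⊆ supermodularOfRange V n) {Ω : Set (V → ℝ)} (hcomplete : IsCompleteFor C Ω)
    (hε : ∀ μ ∈ C, 0 < spread μ → ε ≤ spread μ) (hτ0 : 0 ≤ τ) (hτε : 2 * τ < ε)
    {x : V → ℝ} (hx : ∑ v, x v = n) (hxC : x ∈ support C) {a b : V} (hab : a ≠ b)
    (hseg : ∀ s, 0 ≤ s → s ≤ τ → transfer x a b s ∈ Ω) : transfer x a b τ ∈ support C := by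
  by_contra hnot
  have hmem : ∀ μ ∈ C, ∀ s, transfer x a b s ∈ basePolytope μ ↔
      ∀ S, μ S ≤ ∑ v ∈ S, transfer x a b s v := fun μ hμ s =>
    mem_basePolytope_iff (by rw [sum_univ_transfer, hx, (hC hμ).2])
  -- A state is a position, a function and a tight set to cross. The last clause forces a separating
  -- set to be used whenever one exists.
  let P : ℝ × (Finset V → ℝ) × Finset V → Prop := fun t =>
    t.2.1 ∈ C ∧ 0 ≤ t.1 ∧ t.1 ≤ τ ∧ (∀ S, t.2.1 S ≤ ∑ v ∈ S, transfer x a b t.1 v) ∧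
      t.2.1 t.2.2 = ∑ v ∈ t.2.2, transfer x a b t.1 v ∧ a ∈ t.2.2 ∧ t.2.2 ≠ Finset.univ ∧
        ((∃ K, Separates t.2.1 K) → Separates t.2.1 t.2.2)
  have hblock : ∀ μ ∈ C, ∀ s, 0 ≤ s → s ≤ τ → (∀ S, μ S ≤ ∑ v ∈ S, transfer x a b s v) →
      ∃ s' I, s ≤ s' ∧ P (s', μ, I) := by
    intro μ hμ s hs0 hsτ hle
    by_cases hsep : ∃ K, Separates μ K
    · obtain ⟨K, hK, haK⟩ : ∃ K, Separates μ K ∧ a ∈ K := by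
        obtain ⟨K, hK⟩ := hsep
        by_cases ha : a ∈ K
        · exact ⟨K, hK, ha⟩
        · exact ⟨Kᶜ, hK.compl, by simpa using ha⟩
      -- A separating set is tight at every point of the polytope, so the crossing takes place
      -- without moving.
      refine ⟨s, K, le_rfl, hμ, hs0, hsτ, hle, ?_, haK, hK.2.1, fun _ => hK⟩
      have h1 := Finset.sum_add_sum_compl K (transfer x a b s)
      rw [sum_univ_transfer, hx, ← (hC hμ).2, ← hK.2.2] at h1
      exact le_antisymm (hle K) (by linarith [hle Kᶜ])
    · rcases exists_blocking hab hle hsτ with h | ⟨s', h1, h2, h3, I, haI, hbI, hI⟩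
      · exact absurd (Set.mem_biUnion hμ ((hmem μ hμ τ).2 h)) hnot
      · exact ⟨s', I, h1, hμ, hs0.trans h1, h2, h3, hI, haI,
          fun h => hbI (Finset.eq_univ_iff_forall.1 h b), fun h => absurd h hsep⟩
  have hnext : ∀ t : {t // P t}, ∃ t' : {t // P t}, t.1.1 ≤ t'.1.1 ∧
      t'.1.2.1 ≠ splitting t.1.2.1 t.1.2.2 t.1.2.2ᶜ ∧
      splitting t'.1.2.1 t.1.2.2ᶜ t.1.2.2 = splitting t.1.2.1 t.1.2.2 t.1.2.2ᶜ := by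
    rintro ⟨⟨s, μ, I⟩, hμ, hs0, hsτ, hle, hI, haI, hIu, -⟩
    dsimp only at hμ hs0 hsτ hle hI haI hIu ⊢
    have hface : ∀ S, splitting μ I Iᶜ S ≤ ∑ v ∈ S, transfer x a b s v := splitting_le hle hI Iᶜ
    have hrange : splitting μ I Iᶜ Finset.univ = n := by
      have e : Finset.univ ∪ I = Finset.univ := Finset.union_eq_left.2 (Finset.subset_univ I)
      simp [splitting, e, (hC hμ).2]
    obtain ⟨μ', hμ', hne, heq⟩ := hcomplete μ hμ I Iᶜ
      ⟨⟨a, haI⟩, by rw [Finset.nonempty_iff_ne_empty]; simpa using hIu,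
        disjoint_compl_right, by simp⟩
      ⟨transfer x a b s, (mem_basePolytope_iff (by rw [sum_univ_transfer, hx, hrange])).2 hface,
        hseg s hs0 hsτ⟩
    have hle' : ∀ S, μ' S ≤ ∑ v ∈ S, transfer x a b s v := fun S =>
      ((hC hμ').1.le_splitting Iᶜ I S).trans (heq ▸ hface S)
    obtain ⟨s', I', hss', hP⟩ := hblock μ' hμ' s hs0 hsτ hle'
    exact ⟨⟨(s', μ', I'), hP⟩, hss', hne, heq⟩
  choose next hnext using hnext
  obtain ⟨μ₀, hμ₀, hx₀⟩ := Set.mem_iUnion₂.1 hxC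
  have hzero : transfer x a b 0 = x := by simp [transfer]
  obtain ⟨s₀, I₀, -, hP₀⟩ := hblock μ₀ hμ₀ 0 le_rfl hτ0
    ((hmem μ₀ hμ₀ 0).1 (hzero.symm ▸ hx₀))
  let t : ℕ → {t // P t} := fun k => next^[k] ⟨_, hP₀⟩
  have ht : ∀ k, t (k + 1) = next (t k) := fun k => Function.iterate_succ_apply' _ _ _
  have hstep : ∀ k, (t k).1.1 ≤ (t (k + 1)).1.1 ∧
      (t (k + 1)).1.2.1 ≠ splitting (t k).1.2.1 (t k).1.2.2 (t k).1.2.2ᶜ ∧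
      splitting (t (k + 1)).1.2.1 (t k).1.2.2ᶜ (t k).1.2.2 =
        splitting (t k).1.2.1 (t k).1.2.2 (t k).1.2.2ᶜ := fun k => ht k ▸ hnext (t k)
  have hsuper : ∀ k, IsSupermodular (t k).1.2.1 := fun k => (hC (t k).2.1).1
  have hrange : ∀ k, (t k).1.2.1 Finset.univ = n := fun k => (hC (t k).2.1).2
  refine no_infinite_crossing (ε := ε) (τ := τ) hx (a := a) (b := b) (s := fun k => (t k).1.1)
    (μ := fun k => (t k).1.2.1) (I := fun k => (t k).1.2.2) hsuper hrange
    (fun k => (t k).2.2.2.2.1) (fun k => (t k).2.2.2.2.2.1) (fun k => (t k).2.2.2.2.2.2.1)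
    (fun k => (t k).2.2.2.2.2.2.2.1) (fun k => (hstep k).2.2)
    (monotone_nat_of_le_succ fun k => (hstep k).1) (fun k => (t k).2.2.1)
    (fun k => (t k).2.2.2.1) hτε ?_
  intro k
  by_contra hbad
  -- If no later function satisfied the spread bound, all would have separating sets, and their
  -- number would strictly decrease forever.
  have hsep : ∀ l, k ≤ l → ∃ K, Separates (t l).1.2.1 K := by
    intro l hl
    by_contra hK
    push Not at hK
    refine hbad ⟨l, hl, fun K h1 h2 => ?_⟩
    have := add_compl_le_of_forall_not_separates (hsuper l) (hε _ (t l).2.1) hK h1 h2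
    rwa [hrange l] at this
  have hcard : ∀ i, (separators (t (k + i)).1.2.1).card + i ≤ (separators (t k).1.2.1).card := by
    intro i
    induction i with
    | zero => simp
    | succ i ih =>
      have := card_separators_lt (hsuper (k + i)) (hsuper (k + i + 1))
        (by rw [hrange, hrange]) ((t (k + i)).2.2.2.2.2.2.2.2 (hsep _ (Nat.le_add_right _ _)))
        (hstep (k + i)).2.1 (hstep (k + i)).2.2
      rw [← add_assoc k i 1]
      omega
  have := hcard ((separators (t k).1.2.1).card + 1)
  omega

/-! ### Local constancy of membership in the support -/

theorem norm_transfer_sub_le (x : V → ℝ) (a b : V) (s : ℝ) :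
    ‖transfer x a b s - x‖ ≤ 2 * |s| := by
  have h (c : V) : ‖(Pi.single c 1 : V → ℝ)‖ ≤ 1 := by
    refine (pi_norm_le_iff_of_nonneg zero_le_one).2 fun v => ?_
    rw [Pi.single_apply]
    split_ifs <;> simp
  have h3 := norm_sub_le (Pi.single b 1 : V → ℝ) (Pi.single a 1)
  have h4 : transfer x a b s - x = s • (Pi.single b 1 - Pi.single a 1) := by simp [transfer]
  rw [h4, norm_smul, Real.norm_eq_abs, mul_comm]
  gcongr
  linarith [h a, h b]

/-- Signed version of `transfer_mem_support`, for a segment near the point `q`. -/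
theorem transfer_mem_support_of_ball {n ε R : ℝ} {C : Set (Finset V → ℝ)}
    (hC : C ⊆ supermodularOfRange V n) {Ω : Set (V → ℝ)} (hcomplete : IsCompleteFor C Ω)
    (hε : ∀ μ ∈ C, 0 < spread μ → ε ≤ spread μ) {q : V → ℝ}
    (hball : ∀ y, ∑ v, y v = n → ‖y - q‖ < R → y ∈ Ω) {x : V → ℝ} (hx : ∑ v, x v = n)
    (hxC : x ∈ support C) (a b : V) {c : ℝ} (hc : 2 * |c| < ε) (hxR : ‖x - q‖ + 2 * |c| < R) :
    transfer x a b c ∈ support C := by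
  by_cases hab : a = b
  · subst hab
    simpa [transfer] using hxC
  have hseg : ∀ a' b' s, |s| ≤ |c| → transfer x a' b' s ∈ Ω := fun a' b' s hs => by
    refine hball _ (by rw [sum_univ_transfer, hx]) ?_
    have h1 := norm_transfer_sub_le x a' b' s
    have h2 := norm_sub_le_norm_sub_add_norm_sub (transfer x a' b' s) x q
    linarith
  have hmain : ∀ a' b', a' ≠ b' → transfer x a' b' |c| ∈ support C := fun a' b' hab' =>
    transfer_mem_support hC hcomplete hε (abs_nonneg c) hc hx hxC hab' fun s h0 h1 =>
      hseg a' b' s (by rwa [abs_of_nonneg h0])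
  rcases le_total 0 c with h | h
  · simpa [abs_of_nonneg h] using hmain a b hab
  · have e : transfer x a b c = transfer x b a |c| := by
      simp only [transfer, abs_of_nonpos h, neg_smul, ← smul_neg, neg_sub]
    exact e ▸ hmain b a (Ne.symm hab)

/-- Near any point of `Ω`, membership in the support does not depend on the point. -/
theorem mem_support_of_near [Nonempty V] {n ε R r : ℝ} {C : Set (Finset V → ℝ)}
    (hC : C ⊆ supermodularOfRange V n) {Ω : Set (V → ℝ)} (hcomplete : IsCompleteFor C Ω)
    (hε : ∀ μ ∈ C, 0 < spread μ → ε ≤ spread μ) {q : V → ℝ}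
    (hball : ∀ y, ∑ v, y v = n → ‖y - q‖ < R → y ∈ Ω) (hrε : 4 * r < ε)
    (hrR : r + Fintype.card V * (4 * r) < R) {x y : V → ℝ} (hx : ∑ v, x v = n)
    (hy : ∑ v, y v = n) (hxq : ‖x - q‖ < r) (hyq : ‖y - q‖ < r) (hxC : x ∈ support C) :
    y ∈ support C := by
  obtain ⟨a⟩ := ‹Nonempty V›
  have hr : 0 < r := (norm_nonneg _).trans_lt hxq
  have hc : ∀ v, 2 * |y v - x v| ≤ 4 * r := fun v => by
    have h1 := norm_le_pi_norm (y - x) v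
    have h2 := norm_sub_le_norm_sub_add_norm_sub y q x
    rw [norm_sub_rev q x] at h2
    rw [Pi.sub_apply, Real.norm_eq_abs] at h1
    linarith
  -- Coordinates are corrected one at a time, with a as the reservoir; the corrections sum to zero,
  -- so a also ends at the right value. The term v = a is a trivial move.
  let z : Finset V → V → ℝ := fun S =>
    x + ∑ v ∈ S, (y v - x v) • (Pi.single v 1 - Pi.single a 1)
  have key : ∀ S : Finset V, z S ∈ support C ∧ ∑ v, z S v = n ∧
      ‖z S - q‖ ≤ ‖x - q‖ + S.card * (4 * r) := by
    intro S
    induction S using Finset.induction_on with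
    | empty => simpa [z] using ⟨hxC, hx⟩
    | insert v S hv ih =>
      obtain ⟨h1, h2, h3⟩ := ih
      have e : z (insert v S) = transfer (z S) a v (y v - x v) := by
        simp only [z, transfer, Finset.sum_insert hv]
        abel
      have h4 : ((insert v S).card : ℝ) = S.card + 1 := by
        rw [Finset.card_insert_of_notMem hv]
        simp
      have h5 : ((insert v S).card : ℝ) ≤ Fintype.card V := by
        exact_mod_cast Finset.card_le_univ _
      have h6 : ((insert v S).card : ℝ) * (4 * r) ≤ Fintype.card V * (4 * r) := by gcongr
      have h7 := hc v
      rw [h4] at h6 ⊢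
      rw [e]
      refine ⟨transfer_mem_support_of_ball hC hcomplete hε hball h2 h1 a v (by linarith)
        (by linarith), by rw [sum_univ_transfer, h2], ?_⟩
      have h8 := norm_transfer_sub_le (z S) a v (y v - x v)
      have h9 := norm_sub_le_norm_sub_add_norm_sub (transfer (z S) a v (y v - x v)) (z S) q
      linarith
  have e : z Finset.univ = y := by
    have h1 : ∑ v, (y v - x v) = 0 := by rw [Finset.sum_sub_distrib, hx, hy, sub_self]
    have h2 : ∑ v, (y v - x v) • (Pi.single v 1 : V → ℝ) = y - x := by
      simpa using (pi_eq_sum_univ' (y - x)).symm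
    simp only [z, smul_sub, Finset.sum_sub_distrib, ← Finset.sum_smul] at h1 h2 ⊢
    rw [h2, h1]
    simp
  exact e ▸ (key Finset.univ).1

end SupermodularTiling

/-! ### Connectedness -/

open Filter Topology in
theorem mainTheorem8 {V : Type*} [Fintype V] [DecidableEq V] [Nonempty V] (n : ℝ)
    (C : Set (Finset V → ℝ)) (hC : C ⊆ SupermodularTiling.supermodularOfRange V n)
    (Ω : Set (V → ℝ)) (hΩsub : Ω ⊆ SupermodularTiling.hyperplane V n)
    (hΩopen : IsOpen (Subtype.val ⁻¹' Ω : Set (SupermodularTiling.hyperplane V n)))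
    (hΩconn : IsConnected Ω)
    (hmeet : (SupermodularTiling.support C ∩ Ω).Nonempty)
    (hcomplete : SupermodularTiling.IsCompleteFor C Ω)
    (hpos : SupermodularTiling.IsPositiveFamily C) :
    Ω ⊆ SupermodularTiling.support C := by
  set ε := sInf {s : ℝ | ∃ μ ∈ C, SupermodularTiling.spread μ = s ∧ 0 < s} with hεdef
  have hε0 : 0 < ε := hpos
  have hε : ∀ μ ∈ C, 0 < SupermodularTiling.spread μ → ε ≤ SupermodularTiling.spread μ :=
    fun μ hμ h => csInf_le ⟨0, by rintro _ ⟨_, _, _, h⟩; exact h.le⟩ ⟨μ, hμ, rfl, h⟩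
  obtain ⟨p, hpC, hpΩ⟩ := hmeet
  intro p' hp'
  refine (hΩconn.isPreconnected.induction₂
    (fun y z => y ∈ SupermodularTiling.support C ↔ z ∈ SupermodularTiling.support C)
    ?_ (fun _ _ _ _ _ _ => Iff.trans) (fun _ _ _ _ => Iff.symm) hpΩ hp').1 hpC
  intro q hq
  obtain ⟨R, hR, hball⟩ := Metric.isOpen_iff.1 hΩopen ⟨q, hΩsub hq⟩ hq
  have hball' : ∀ y, ∑ v, y v = n → ‖y - q‖ < R → y ∈ Ω := fun y hy hyR =>
    hball (show (⟨y, hy⟩ : SupermodularTiling.hyperplane V n) ∈ _ by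
      rwa [Metric.mem_ball, Subtype.dist_eq, dist_eq_norm])
  -- Coordinates of two points of the r-ball differ by less than 2r, so each of the |V| transfers
  -- moves by at most 4r in norm.
  obtain ⟨r, hr0, hr1, hr2⟩ : ∃ r : ℝ, 0 < r ∧ 4 * r < ε ∧ r + Fintype.card V * (4 * r) < R := by
    have h1 : ∀ᶠ r : ℝ in 𝓝[>] 0, 4 * r < ε :=
      nhdsWithin_le_nhds ((by fun_prop : Continuous fun r : ℝ => 4 * r).continuousAt.eventually_lt
        continuousAt_const (by simpa))
    have h2 : ∀ᶠ r : ℝ in 𝓝[>] 0, r + Fintype.card V * (4 * r) < R :=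
      nhdsWithin_le_nhds ((by fun_prop : Continuous fun r : ℝ =>
        r + Fintype.card V * (4 * r)).continuousAt.eventually_lt continuousAt_const (by simpa))
    obtain ⟨r, h3, h4, h5⟩ := ((eventually_mem_nhdsWithin).and (h1.and h2)).exists
    exact ⟨r, h3, h4, h5⟩
  filter_upwards [self_mem_nhdsWithin, mem_nhdsWithin_of_mem_nhds (Metric.ball_mem_nhds q hr0)]
    with y hy hyq
  rw [Metric.mem_ball, dist_eq_norm] at hyq
  have hqq : ‖q - q‖ < r := by simpa
  exact ⟨SupermodularTiling.mem_support_of_near hC hcomplete hε hball' hr1 hr2 (hΩsub hq)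
      (hΩsub hy) hqq hyq,
    SupermodularTiling.mem_support_of_near hC hcomplete hε hball' hr1 hr2 (hΩsub hy)
      (hΩsub hq) hyq hqq⟩
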